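/- Let $G=(V,E)$ be a connected, non-bipartite, simple (unweighted) graph, finite or infinite, that is regular of some finite degree $d$. For $x\in V$ write $w(x)$ for the degree of $x$ (so $w(x)=d$), let $\ell^2(V,w)$ be the Hilbert space of functions $f:V\to\mathbb C$ with inner product $\langle f,g\rangle_w=\sum_{x\in V}w(x)f(x)\overline{g(x)}$, and let $P$ be the transition operator of simple random walk, $(Pf)(x)=\frac1{w(x)}\sum_{y\sim x}f(y)$. Let $Q=I+P$ be the probabilistic signless Laplacian, a bounded self-adjoint operator on $\ell^2(V,w)$, and let $I_Q$ be its resolution of identity (so $I_Q(S)=\mathbf 1_S(Q)$ is the spectral projection of $Q$ on $S$). The vertex spectral measure of $Q$ at $x$ is $$\mu_x^Q(\delta)=\bigl\langle I_Q([0,\delta])e_x,e_x\bigr\rangle_w,\qquad e_x=\frac{\mathbf 1_x}{\sqrt{w(x)}} .$$ Then $$\mu_x^Q(\delta)\le 10\sqrt{\delta}\qquad\text{for all } x\in V \text{ and } 0\le\delta\le 2 .$$ Moreover, if $G$ is finite with $n=|V|$ vertices, then $P$ and $Q$ each have $n$ real eigenvalues counted with multiplicity, and if these are listed in nondecreasing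 order as $\lambda^P_1\le\dots\le\lambda^P_n$ and $\lambda^Q_1\le\dots\le\lambda^Q_n$, then for all $1\le k\le n$ $$\lambda^Q_k\ge\frac{k^2}{100n^2}\qquad\text{and}\qquad \lambda^P_k\ge-1+\frac{k^2}{100n^2} .$$ -/

import Mathlib

open MeasureTheory
open scoped ENNReal

/-! ### Spectral projections of bounded self-adjoint operators -/

section SpectralProjection

variable {H : Type*} [NormedAddCommGroup H] [InnerProductSpace ℂ H] [CompleteSpace H]

/-- For a bounded self-adjoint operator `T` and a closed set `S` of reals, the spectral subspace
of `T` over `S`: the vectors annihilated by `f(T)` (continuous functional calculus) for every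
continuous `f : ℝ → ℝ` that vanishes on `S`. It is the range of `1_S(T)`. -/
noncomputable def spectralSubspace (T : H →L[ℂ] H) (S : Set ℝ) : Submodule ℂ H :=
  ⨅ f : {f : ℝ → ℝ // Continuous f ∧ ∀ s ∈ S, f s = 0}, (cfc f.1 T : H →L[ℂ] H).ker

theorem isClosed_spectralSubspace (T : H →L[ℂ] H) (S : Set ℝ) :
    IsClosed (spectralSubspace T S : Set H) := by
  unfold spectralSubspace
  rw [Submodule.coe_iInf]
  exact isClosed_iInter fun f => ContinuousLinearMap.isClosed_ker _

instance completeSpace_spectralSubspace (T : H →L[ℂ] H) (S : Set ℝ) :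
    CompleteSpace (spectralSubspace T S) :=
  (isClosed_spectralSubspace T S).completeSpace_coe

/-- The resolution of identity `I_T` of a bounded self-adjoint operator `T`, evaluated at a closed
set `S`: the spectral projection `I_T(S) = 1_S(T)`, i.e. the orthogonal projection onto the
spectral subspace of `T` over `S`. -/
noncomputable def spectralProjection (T : H →L[ℂ] H) (S : Set ℝ) : H →L[ℂ] H :=
  (spectralSubspace T S).starProjection

end SpectralProjection

namespace SimpleGraph

variable {V : Type*} (G : SimpleGraph V)

/-! ### The Hilbert space `ℓ²(V, w)`, where `w x` is the degree of `x` -/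

section Operators

variable [G.LocallyFinite]

/-- The measure `∑ x, w(x) δ_x` on the vertex set (all subsets are measurable). -/
noncomputable def vertexMeasure : @Measure V ⊤ :=
  @Measure.sum V V ⊤ fun x =>
    (G.degree x : ℝ≥0∞) • @Measure.dirac V ⊤ x

/-- The complex Hilbert space `ℓ²(V, w)`, with inner product `∑ x, w(x) (conj (f x)) (g x)`. -/
abbrev WeightedL2 : Type _ := Lp ℂ 2 G.vertexMeasure

theorem lintegral_vertexMeasure (f : V → ℝ≥0∞) :
    @lintegral V ⊤ G.vertexMeasure f = ∑' x, (G.degree x : ℝ≥0∞) * f x := by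
  let _ : MeasurableSpace V := ⊤
  unfold vertexMeasure
  rw [lintegral_sum_measure]
  congr 1; ext x
  rw [lintegral_smul_measure,
    lintegral_dirac' x (fun _ _ => trivial), smul_eq_mul]

theorem ae_vertexMeasure_iff (p : V → Prop) :
    (∀ᵐ x ∂ G.vertexMeasure, p x) ↔ ∀ x, G.degree x ≠ 0 → p x := by
  let _ : MeasurableSpace V := ⊤
  unfold vertexMeasure
  rw [Measure.ae_sum_iff' (MeasurableSpace.measurableSet_top : MeasurableSet[⊤] {x | p x})]
  refine forall_congr' fun x => ?_
  by_cases h : G.degree x = 0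
  · simp [h]
  · have h' : (G.degree x : ℝ≥0∞) ≠ 0 := by exact_mod_cast h
    rw [ae_iff, Measure.smul_apply, smul_eq_mul, mul_eq_zero,
      Measure.dirac_apply' x (MeasurableSpace.measurableSet_top : MeasurableSet[⊤] _)]
    simp [h', h]

/-! ### The transition operator and the probabilistic signless Laplacian -/

open Classical in
/-- The transition matrix `P` of simple random walk: `P(x, y) = 1 / w(x)` if `x` and `y` are
adjacent, and `0` otherwise. -/
noncomputable def transitionMatrix : Matrix V V ℝ :=
  Matrix.of fun x y => if G.Adj x y then 1 / (G.degree x : ℝ) else 0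

/-- `(P f)(x) = ∑_{y ∼ x} P(x, y) f(y)` on arbitrary functions. -/
noncomputable def transitionFun (f : V → ℂ) (x : V) : ℂ :=
  ∑ y ∈ G.neighborFinset x, (G.transitionMatrix x y : ℂ) * f y

theorem transitionFun_eq (f : V → ℂ) (x : V) :
    G.transitionFun f x = (G.degree x : ℂ)⁻¹ * ∑ y ∈ G.neighborFinset x, f y := by
  unfold transitionFun
  rw [Finset.mul_sum]
  refine Finset.sum_congr rfl fun y hy => ?_
  have : G.Adj x y := by simpa using hy
  simp [transitionMatrix, this]

theorem tsum_degree_mul (a : V → ℝ≥0∞) :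
    ∑' x, ∑ y ∈ G.neighborFinset x, a y = ∑' y, (G.degree y : ℝ≥0∞) * a y := by
  classical
  have h1 : ∀ x, ∑ y ∈ G.neighborFinset x, a y = ∑' y, if G.Adj x y then a y else 0 := by
    intro x
    rw [tsum_eq_sum (s := G.neighborFinset x)]
    · exact Finset.sum_congr rfl fun y hy => by
        rw [if_pos (by simpa using hy)]
    · intro y hy
      rw [if_neg (by simpa using hy)]
  simp_rw [h1]
  rw [ENNReal.tsum_comm]
  congr 1; ext y
  rw [tsum_eq_sum (s := G.neighborFinset y)]
  · rw [Finset.sum_congr rfl (g := fun _ => a y) fun x hx => by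
      rw [if_pos (G.adj_symm (by simpa using hx))]]
    simp
  · intro x hx
    rw [if_neg fun h => hx (by simpa using G.adj_symm h)]

theorem degree_mul_sq_transitionFun_le (f : V → ℂ) (x : V) :
    (G.degree x : ℝ≥0∞) * ‖G.transitionFun f x‖ₑ ^ (2 : ℝ) ≤
      ∑ y ∈ G.neighborFinset x, ‖f y‖ₑ ^ (2 : ℝ) := by
  have key : (G.degree x : ℝ) * ‖G.transitionFun f x‖ ^ 2 ≤
      ∑ y ∈ G.neighborFinset x, ‖f y‖ ^ 2 := by
    rw [transitionFun_eq, norm_mul, norm_inv, Complex.norm_natCast, mul_pow]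
    have h1 : ‖∑ y ∈ G.neighborFinset x, f y‖ ^ 2 ≤
        (G.degree x : ℝ) * ∑ y ∈ G.neighborFinset x, ‖f y‖ ^ 2 := by
      refine (pow_le_pow_left₀ (norm_nonneg _) (norm_sum_le _ _) 2).trans ?_
      rw [← G.card_neighborFinset_eq_degree]
      exact sq_sum_le_card_mul_sum_sq
    rcases Nat.eq_zero_or_pos (G.degree x) with h | h
    · simp only [h]
      simp
      positivity
    · have hd : (0 : ℝ) < G.degree x := by exact_mod_cast h
      calc (G.degree x : ℝ) * ((G.degree x : ℝ)⁻¹ ^ 2 * ‖∑ y ∈ G.neighborFinset x, f y‖ ^ 2)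
          ≤ (G.degree x : ℝ) * ((G.degree x : ℝ)⁻¹ ^ 2 *
              ((G.degree x : ℝ) * ∑ y ∈ G.neighborFinset x, ‖f y‖ ^ 2)) := by gcongr
        _ = _ := by field_simp
  have conv : ∀ z : ℂ, ‖z‖ₑ ^ (2 : ℝ) = ENNReal.ofReal (‖z‖ ^ 2) := by
    intro z
    rw [← ofReal_norm, ENNReal.ofReal_rpow_of_nonneg (norm_nonneg _) (by norm_num)]
    simp
  simp_rw [conv]
  rw [← ENNReal.ofReal_sum_of_nonneg (fun _ _ => by positivity), ← ENNReal.ofReal_natCast,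
    ← ENNReal.ofReal_mul (by positivity)]
  exact ENNReal.ofReal_le_ofReal key

theorem eLpNorm_transitionFun_le (f : V → ℂ) :
    eLpNorm (G.transitionFun f) 2 G.vertexMeasure ≤
      eLpNorm f 2 G.vertexMeasure := by
  rw [eLpNorm_eq_lintegral_rpow_enorm_toReal (by norm_num) (by norm_num),
    eLpNorm_eq_lintegral_rpow_enorm_toReal (by norm_num) (by norm_num),
    lintegral_vertexMeasure, lintegral_vertexMeasure]
  refine ENNReal.rpow_le_rpow ?_ (by positivity)
  rw [← G.tsum_degree_mul fun y => ‖f y‖ₑ ^ (2 : ℝ≥0∞).toReal]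
  exact ENNReal.tsum_le_tsum fun x => G.degree_mul_sq_transitionFun_le f x

theorem memLp_transitionFun {f : V → ℂ} (hf : MemLp f 2 G.vertexMeasure) :
    MemLp (G.transitionFun f) 2 G.vertexMeasure := by
  let _ : MeasurableSpace V := ⊤
  have hm : Measurable (G.transitionFun f) := fun _ _ => trivial
  exact ⟨hm.aestronglyMeasurable, (G.eLpNorm_transitionFun_le f).trans_lt hf.2⟩

theorem transitionFun_congr_ae {f g : V → ℂ} (h : f =ᵐ[G.vertexMeasure] g) :
    G.transitionFun f = G.transitionFun g := by
  have h' := (G.ae_vertexMeasure_iff _).1 h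
  ext x
  refine Finset.sum_congr rfl fun y hy => ?_
  have hxy : G.Adj x y := by simpa using hy
  rw [h' y]
  exact ((G.degree_pos_iff_exists_adj y).2 ⟨x, hxy.symm⟩).ne'

/-- The transition operator `P` of simple random walk, on `ℓ²(V, w)`. -/
noncomputable def transitionOp : G.WeightedL2 →L[ℂ] G.WeightedL2 :=
  LinearMap.mkContinuous
    { toFun := fun f => (G.memLp_transitionFun (Lp.memLp f)).toLp _
      map_add' := fun f g => by
        rw [← MemLp.toLp_add]
        refine MemLp.toLp_congr _ _ (Filter.Eventually.of_forall fun x => ?_)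
        rw [G.transitionFun_congr_ae (Lp.coeFn_add f g)]
        simp [transitionFun, mul_add, Finset.sum_add_distrib]
      map_smul' := fun c f => by
        rw [RingHom.id_apply, ← MemLp.toLp_const_smul]
        refine MemLp.toLp_congr _ _ (Filter.Eventually.of_forall fun x => ?_)
        rw [G.transitionFun_congr_ae (Lp.coeFn_smul c f)]
        simp [transitionFun, Finset.mul_sum, mul_left_comm] }
    1 fun f => by
      rw [one_mul]
      change ‖(G.memLp_transitionFun (Lp.memLp f)).toLp _‖ ≤ _
      rw [Lp.norm_toLp, Lp.norm_def]
      exact ENNReal.toReal_mono (Lp.eLpNorm_ne_top f)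
        (G.eLpNorm_transitionFun_le f)

/-- The probabilistic signless Laplacian `Q = I + P`, on `ℓ²(V, w)`. -/
noncomputable def signlessLaplacian : G.WeightedL2 →L[ℂ] G.WeightedL2 :=
  ContinuousLinearMap.id ℂ G.WeightedL2 + G.transitionOp

theorem hasSum_inner (f g : G.WeightedL2) :
    HasSum (fun x => (G.degree x : ℂ) * inner ℂ (f x) (g x)) (inner ℂ f g) := by
  let _ : MeasurableSpace V := ⊤
  have h : Integrable (fun x => inner ℂ (f x) (g x)) G.vertexMeasure := L2.integrable_inner f g
  have h2 := hasSum_integral_measure h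
  have h3 : ∀ x, ∫ y, inner ℂ (f y) (g y) ∂((G.degree x : ℝ≥0∞) • Measure.dirac x) =
      (G.degree x : ℂ) * inner ℂ (f x) (g x) := by
    intro x
    rw [integral_smul_measure, integral_dirac]
    simp
  rw [L2.inner_def]
  simp_rw [h3] at h2
  exact h2

theorem transitionOp_apply (f : G.WeightedL2) {x : V} (hx : G.degree x ≠ 0) :
    G.transitionOp f x = G.transitionFun f x :=
  (G.ae_vertexMeasure_iff _).1 (MemLp.coeFn_toLp (G.memLp_transitionFun (Lp.memLp f))) x hx

theorem summable_degree_mul_norm_sq (f : G.WeightedL2) :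
    Summable fun x => (G.degree x : ℝ) * ‖f x‖ ^ 2 := by
  have h := (G.hasSum_inner f f).summable.norm
  refine h.congr fun x => ?_
  simp [sq]

theorem isSelfAdjoint_transitionOp : IsSelfAdjoint G.transitionOp := by
  classical
  rw [ContinuousLinearMap.isSelfAdjoint_iff_isSymmetric]
  intro f g
  let F : V × V → ℂ := fun p => if G.Adj p.1 p.2 then inner ℂ (f p.2) (g p.1) else 0
  have hL1 : ∀ (a : V → ℂ) (x : V), HasSum (fun y => if G.Adj x y then a y else 0)
      (∑ y ∈ G.neighborFinset x, a y) := by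
    intro a x
    have : ∑ y ∈ G.neighborFinset x, a y =
        ∑ y ∈ G.neighborFinset x, if G.Adj x y then a y else 0 :=
      Finset.sum_congr rfl fun y hy => by rw [if_pos (by simpa using hy)]
    rw [this]
    exact hasSum_sum_of_ne_finset_zero fun y hy => by rw [if_neg (by simpa using hy)]
  have hR1 : ∀ (a : V → ℝ) (x : V), HasSum (fun y => if G.Adj x y then a y else 0)
      (∑ y ∈ G.neighborFinset x, a y) := by
    intro a x
    have : ∑ y ∈ G.neighborFinset x, a y =
        ∑ y ∈ G.neighborFinset x, if G.Adj x y then a y else 0 :=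
      Finset.sum_congr rfl fun y hy => by rw [if_pos (by simpa using hy)]
    rw [this]
    exact hasSum_sum_of_ne_finset_zero fun y hy => by rw [if_neg (by simpa using hy)]
  have hsum1 : ∀ h : G.WeightedL2,
      Summable fun p : V × V => if G.Adj p.1 p.2 then ‖h p.1‖ ^ 2 else 0 := by
    intro h
    rw [summable_prod_of_nonneg (fun p => by dsimp only; split_ifs <;> positivity)]
    refine ⟨fun x => (hR1 (fun _ => ‖h x‖ ^ 2) x).summable, ?_⟩
    refine (G.summable_degree_mul_norm_sq h).congr fun x => ?_
    rw [(hR1 (fun _ => ‖h x‖ ^ 2) x).tsum_eq]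
    simp
  have hsum2 : ∀ h : G.WeightedL2,
      Summable fun p : V × V => if G.Adj p.1 p.2 then ‖h p.2‖ ^ 2 else 0 := by
    intro h
    refine ((Equiv.prodComm V V).summable_iff.2 (hsum1 h)).congr fun p => ?_
    simp [G.adj_comm]
  have hF : Summable F := by
    refine Summable.of_norm_bounded ((hsum2 f).add (hsum1 g)) fun p => ?_
    simp only [F]
    split_ifs
    · refine (norm_inner_le_norm _ _).trans ?_
      nlinarith [sq_nonneg (‖f p.2‖ - ‖g p.1‖), sq_nonneg ‖f p.2‖, sq_nonneg ‖g p.1‖]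
    · simp
  have hd : ∀ x, (G.degree x : ℂ) ≠ 0 ∨ G.neighborFinset x = ∅ := by
    intro x
    by_cases h : G.degree x = 0
    · right; rwa [← Finset.card_eq_zero, G.card_neighborFinset_eq_degree]
    · left; exact_mod_cast h
  have e1 : ∀ x, (G.degree x : ℂ) * inner ℂ (G.transitionOp f x) (g x) =
      ∑ y ∈ G.neighborFinset x, inner ℂ (f y) (g x) := by
    intro x
    rcases hd x with h | h
    · rw [G.transitionOp_apply f (by exact_mod_cast h), transitionFun_eq, ← sum_inner]
      simp only [RCLike.inner_apply, map_mul, map_inv₀, map_natCast]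
      field_simp
    · have : G.degree x = 0 := by rw [← G.card_neighborFinset_eq_degree, h]; rfl
      simp [h, this]
  have e2 : ∀ x, (G.degree x : ℂ) * inner ℂ (f x) (G.transitionOp g x) =
      ∑ y ∈ G.neighborFinset x, inner ℂ (f x) (g y) := by
    intro x
    rcases hd x with h | h
    · rw [G.transitionOp_apply g (by exact_mod_cast h), transitionFun_eq, ← inner_sum]
      simp only [RCLike.inner_apply]
      field_simp
    · have : G.degree x = 0 := by rw [← G.card_neighborFinset_eq_degree, h]; rfl
      simp [h, this]
  have s1 := G.hasSum_inner (G.transitionOp f) g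
  have s2 := G.hasSum_inner f (G.transitionOp g)
  simp_rw [e1] at s1
  simp_rw [e2] at s2
  have t1 := hF.hasSum.prod_fiberwise fun x => hL1 (fun y => inner ℂ (f y) (g x)) x
  have t2 := ((Equiv.prodComm V V).hasSum_iff.2 hF.hasSum).prod_fiberwise
    (g := fun x => ∑ y ∈ G.neighborFinset x, inner ℂ (f x) (g y)) fun x => by
      refine (hL1 (fun y => inner ℂ (f x) (g y)) x).congr_fun fun y => ?_
      simp [F, G.adj_comm]
  exact (s1.unique t1).trans (t2.unique s2)

/-- `Q` is self-adjoint, so that its functional calculus is available. -/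
theorem isSelfAdjoint_signlessLaplacian : IsSelfAdjoint G.signlessLaplacian :=
  (IsSelfAdjoint.one (G.WeightedL2 →L[ℂ] G.WeightedL2)).add G.isSelfAdjoint_transitionOp

/-! ### The vertex spectral measure -/

theorem vertexMeasure_singleton_ne_top (x : V) : G.vertexMeasure {x} ≠ ∞ := by
  let _ : MeasurableSpace V := ⊤
  rw [← lintegral_indicator_one (MeasurableSpace.measurableSet_top : MeasurableSet[⊤] {x}),
    lintegral_vertexMeasure, tsum_eq_single x]
  · simp
  · intro y hy
    simp [hy]

/-- The vector `e_x = 1_x / √w(x)` of `ℓ²(V, w)`. -/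
noncomputable def vertexVector (x : V) : G.WeightedL2 :=
  indicatorConstLp 2 (MeasurableSpace.measurableSet_top : MeasurableSet[⊤] {x})
    (G.vertexMeasure_singleton_ne_top x) (((√(G.degree x : ℝ))⁻¹ : ℝ) : ℂ)

/-- The vertex spectral measure of `Q` at `x`: `μ_x^Q(δ) = ⟨I_Q([0, δ]) e_x, e_x⟩_w`. -/
noncomputable def vertexSpectralMeasure (x : V) (δ : ℝ) : ℝ :=
  RCLike.re (inner ℂ (spectralProjection G.signlessLaplacian (Set.Icc 0 δ) (G.vertexVector x))
    (G.vertexVector x))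

end Operators

end SimpleGraph

/-- `lam` lists the eigenvalues of the square matrix `M` over `ℝ` in nondecreasing order, each
repeated according to its multiplicity as a root of the characteristic polynomial; in particular,
`M` has `n` real eigenvalues counted with multiplicity. -/
def IsOrderedSpectrum {V : Type*} [Fintype V] [DecidableEq V] (M : Matrix V V ℝ)
    {n : ℕ} (lam : Fin n → ℝ) : Prop :=
  Monotone lam ∧ M.charpoly.roots = (Finset.univ : Finset (Fin n)).val.map lam

/-!
On odd functions of the bipartite double cover, `Q` acts as the Laplacian. A function `h` on `V`
lifts to the double cover as `h⁺` on one sheet and `h⁻` on the other: the mass is unchanged, the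
Dirichlet energy of the lift is at most `∑ (h v + h u) ^ 2`, and at each vertex of `G` the lift
vanishes on one of the two copies. An odd closed walk at `x` joins the two copies of `x`, so the
squares of the lift telescope along a geodesic between them, and by Cauchy–Schwarz `h x ^ 4` is at
most a multiple of the energy times the mass on the geodesic. A vertex has at most three neighbours
on a geodesic, so the mass on it is at most `2 * (3 * mass + energy) / d`. If the energy is at most
`2 * δ * d` times the mass, this gives `h x ^ 2 ≤ 10 * √δ * mass`.

The spectral projection `F` of `e_x` on `[0, δ]` satisfies the energy bound, and both its norm and
its value at `x` are determined by the spectral measure: this bounds `μ_x^Q(δ)`. On a finite graph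
the same estimate bounds the diagonal entries of the spectral projection of `1 + P`, and its trace
counts the eigenvalues at most `δ`: there are at most `10 * n * √δ` of them.
-/

section EnergyAlongPath

theorem sq_sub_sq_sq_le_sum_mul_sum (c : ℕ → ℝ) (r : ℕ) :
    (c 0 ^ 2 - c r ^ 2) ^ 2 ≤
      (∑ i ∈ Finset.range r, (c i - c (i + 1)) ^ 2) *
        (4 * ∑ i ∈ Finset.range (r + 1), c i ^ 2) := by
  have telescope : c 0 ^ 2 - c r ^ 2 =
      ∑ i ∈ Finset.range r, (c i - c (i + 1)) * (c i + c (i + 1)) := by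
    rw [← Finset.sum_range_sub' (fun i => c i ^ 2)]
    exact Finset.sum_congr rfl fun i _ => by ring
  have sum_add_sq_le : ∑ i ∈ Finset.range r, (c i + c (i + 1)) ^ 2 ≤
      4 * ∑ i ∈ Finset.range (r + 1), c i ^ 2 := by
    calc ∑ i ∈ Finset.range r, (c i + c (i + 1)) ^ 2
        ≤ ∑ i ∈ Finset.range r, (2 * c i ^ 2 + 2 * c (i + 1) ^ 2) :=
          Finset.sum_le_sum fun i _ => by nlinarith [sq_nonneg (c i - c (i + 1))]
      _ = 2 * ∑ i ∈ Finset.range r, c i ^ 2 + 2 * ∑ i ∈ Finset.range r, c (i + 1) ^ 2 := by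
          rw [Finset.sum_add_distrib, Finset.mul_sum, Finset.mul_sum]
      _ ≤ 4 * ∑ i ∈ Finset.range (r + 1), c i ^ 2 := by
          have h_first := Finset.sum_range_succ (fun i => c i ^ 2) r
          have h_last := Finset.sum_range_succ' (fun i => c i ^ 2) r
          linarith [sq_nonneg (c r), sq_nonneg (c 0)]
  rw [telescope]
  exact (Finset.sum_mul_sq_le_sq_mul_sq _ _ _).trans <|
    mul_le_mul_of_nonneg_left sum_add_sq_le (Finset.sum_nonneg fun _ _ => sq_nonneg _)

theorem card_mul_sq_le {ι : Type*} (s : Finset ι) (a : ℝ) (f : ι → ℝ) :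
    s.card * a ^ 2 ≤ 2 * (∑ i ∈ s, f i ^ 2 + ∑ i ∈ s, (a - f i) ^ 2) := by
  rw [← nsmul_eq_mul, ← Finset.sum_const, ← Finset.sum_add_distrib, Finset.mul_sum]
  exact Finset.sum_le_sum fun i _ => by nlinarith [sq_nonneg (a - 2 * f i)]

end EnergyAlongPath

section Geodesic

open SimpleGraph

variable {V : Type*} {G : SimpleGraph V} {x y : V} {p : G.Walk x y}

theorem dist_getVert_of_length_eq_dist (hp : p.length = G.dist x y) {i : ℕ}
    (hi : i ≤ p.length) : G.dist x (p.getVert i) = i := by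
  rw [← length_eq_dist_of_subwalk hp (p.isSubwalk_take i), Walk.take_length,
    min_eq_left hi]

-- A bound on all finite partial sums stands for a bound on the total over the possibly infinite
-- vertex set, and needs no summability.
theorem sum_range_getVert_le (hp : p.length = G.dist x y) {a : V → ℝ} {m : ℝ}
    (hm : ∀ s : Finset V, ∑ v ∈ s, a v ≤ m) :
    ∑ i ∈ Finset.range (p.length + 1), a (p.getVert i) ≤ m := by
  classical
  have hinj : Set.InjOn p.getVert (Finset.range (p.length + 1)) :=
    (p.isPath_of_length_eq_dist hp).getVert_injOn.mono fun i hi => by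
      simpa [Nat.lt_succ_iff] using hi
  rw [← Finset.sum_image hinj]
  exact hm _

variable [G.LocallyFinite]

-- On a geodesic the index of a vertex is its distance from `x`, and neighbours of `u` are at
-- distance `G.dist x u - 1`, `G.dist x u` or `G.dist x u + 1`.
theorem card_getVert_adj_le_three [DecidableEq V] (hp : p.length = G.dist x y) (u : V) :
    ({i ∈ Finset.range (p.length + 1) | u ∈ G.neighborFinset (p.getVert i)}).card ≤ 3 := by
  calc _ ≤ (Finset.Icc (G.dist x u - 1) (G.dist x u + 1)).card := by
        refine Finset.card_le_card fun i hi => ?_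
        obtain ⟨hi, hadj⟩ : i < p.length + 1 ∧ G.Adj (p.getVert i) u := by simpa using hi
        have hdist := hadj.diff_dist_adj (u := x)
        rw [dist_getVert_of_length_eq_dist hp (Nat.lt_succ_iff.1 hi)] at hdist
        rw [Finset.mem_Icc]
        omega
    _ ≤ 3 := by rw [Nat.card_Icc]; omega

theorem sum_range_sum_neighborFinset_getVert_le (hp : p.length = G.dist x y) {a : V → ℝ}
    (ha : 0 ≤ a) {m : ℝ} (hm : ∀ s : Finset V, ∑ v ∈ s, a v ≤ m) :
    ∑ i ∈ Finset.range (p.length + 1), ∑ u ∈ G.neighborFinset (p.getVert i), a u ≤ 3 * m := by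
  classical
  let N := (Finset.range (p.length + 1)).biUnion fun i => G.neighborFinset (p.getVert i)
  calc ∑ i ∈ Finset.range (p.length + 1), ∑ u ∈ G.neighborFinset (p.getVert i), a u
      = ∑ u ∈ N, ∑ i ∈ Finset.range (p.length + 1) with u ∈ G.neighborFinset (p.getVert i),
          a u :=
        Finset.sum_comm' fun i u => by
          simp only [N, Finset.mem_filter, Finset.mem_biUnion]
          exact ⟨fun h => ⟨h, i, h⟩, fun h => h.1⟩
    _ ≤ ∑ u ∈ N, 3 * a u := by
        refine Finset.sum_le_sum fun u _ => ?_
        rw [Finset.sum_const, nsmul_eq_mul]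
        exact mul_le_mul_of_nonneg_right (mod_cast card_getVert_adj_le_three hp u) (ha u)
    _ ≤ 3 * m := by
        rw [← Finset.mul_sum]
        exact mul_le_mul_of_nonneg_left (hm N) (by norm_num)

theorem sum_range_sq_sub_getVert_succ_le (p : G.Walk x y) (g : V → ℝ) :
    ∑ i ∈ Finset.range p.length, (g (p.getVert i) - g (p.getVert (i + 1))) ^ 2 ≤
      ∑ i ∈ Finset.range (p.length + 1),
        ∑ u ∈ G.neighborFinset (p.getVert i), (g (p.getVert i) - g u) ^ 2 := by
  calc ∑ i ∈ Finset.range p.length, (g (p.getVert i) - g (p.getVert (i + 1))) ^ 2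
      ≤ ∑ i ∈ Finset.range p.length,
          ∑ u ∈ G.neighborFinset (p.getVert i), (g (p.getVert i) - g u) ^ 2 := by
        refine Finset.sum_le_sum fun i hi => ?_
        have hmem : p.getVert (i + 1) ∈ G.neighborFinset (p.getVert i) := by
          simpa using p.adj_getVert_succ (Finset.mem_range.1 hi)
        exact Finset.single_le_sum (f := fun u => (g (p.getVert i) - g u) ^ 2)
          (fun _ _ => sq_nonneg _) hmem
    _ ≤ _ := Finset.sum_le_sum_of_subset_of_nonneg (Finset.range_mono (Nat.le_succ _))
        fun _ _ _ => Finset.sum_nonneg fun _ _ => sq_nonneg _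

theorem mul_sum_range_sq_getVert_le (hp : p.length = G.dist x y) {d : ℕ}
    (hd : ∀ v, d ≤ G.degree v) {g : V → ℝ} {m E : ℝ} (hm : ∀ s : Finset V, ∑ v ∈ s, g v ^ 2 ≤ m)
    (hE : ∀ s : Finset V, ∑ v ∈ s, ∑ u ∈ G.neighborFinset v, (g v - g u) ^ 2 ≤ E) :
    d * ∑ i ∈ Finset.range (p.length + 1), g (p.getVert i) ^ 2 ≤ 2 * (3 * m + E) := by
  have mass_neighbors :=
    sum_range_sum_neighborFinset_getVert_le hp (fun v => sq_nonneg (g v)) hm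
  have energy_path := sum_range_getVert_le hp hE
  calc d * ∑ i ∈ Finset.range (p.length + 1), g (p.getVert i) ^ 2
      ≤ ∑ i ∈ Finset.range (p.length + 1),
          2 * (∑ u ∈ G.neighborFinset (p.getVert i), g u ^ 2 +
            ∑ u ∈ G.neighborFinset (p.getVert i), (g (p.getVert i) - g u) ^ 2) := by
        rw [Finset.mul_sum]
        refine Finset.sum_le_sum fun i _ => le_trans ?_ (card_mul_sq_le _ _ g)
        rw [card_neighborFinset_eq_degree]
        gcongr
        exact hd _
    _ ≤ 2 * (3 * m + E) := by
        rw [← Finset.mul_sum, Finset.sum_add_distrib]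
        gcongr

theorem mul_sq_sub_sq_sq_le {d : ℕ} (hd : ∀ v, d ≤ G.degree v) (hxy : G.Reachable x y)
    {g : V → ℝ} {m E : ℝ} (hm : ∀ s : Finset V, ∑ v ∈ s, g v ^ 2 ≤ m)
    (hE : ∀ s : Finset V, ∑ v ∈ s, ∑ u ∈ G.neighborFinset v, (g v - g u) ^ 2 ≤ E) :
    d * (g x ^ 2 - g y ^ 2) ^ 2 ≤ 8 * E * (3 * m + E) := by
  obtain ⟨p, hp⟩ := hxy.exists_walk_length_eq_dist
  have energy_steps :=
    (sum_range_sq_sub_getVert_succ_le p g).trans (sum_range_getVert_le hp hE)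
  have mass_path := mul_sum_range_sq_getVert_le hp hd hm hE
  have hE₀ : 0 ≤ E := by simpa using hE ∅
  have telescope := sq_sub_sq_sq_le_sum_mul_sum (fun i => g (p.getVert i)) p.length
  rw [Walk.getVert_zero, Walk.getVert_length] at telescope
  calc d * (g x ^ 2 - g y ^ 2) ^ 2
      ≤ d * (E * (4 * ∑ i ∈ Finset.range (p.length + 1), g (p.getVert i) ^ 2)) := by
        refine mul_le_mul_of_nonneg_left (telescope.trans ?_) (Nat.cast_nonneg d)
        exact mul_le_mul_of_nonneg_right energy_steps
          (mul_nonneg (by norm_num) (Finset.sum_nonneg fun _ _ => sq_nonneg _))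
    _ = 4 * E * (d * ∑ i ∈ Finset.range (p.length + 1), g (p.getVert i) ^ 2) := by ring
    _ ≤ 4 * E * (2 * (3 * m + E)) := by gcongr
    _ = 8 * E * (3 * m + E) := by ring

end Geodesic

section BipartiteDoubleCover

open SimpleGraph

variable {V : Type*} {G : SimpleGraph V}

theorem reachable_bipartiteDoubleCover {x y : V} (p : G.Walk x y) :
    G.bipartiteDoubleCover.Reachable (.inl x) (if Even p.length then .inl y else .inr y) := by
  induction p using Walk.concatRec with
  | Hnil => simp
  | @Hconcat u v w p h ih =>
    refine ih.trans (Adj.reachable ?_)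
    by_cases hp : Even p.length <;> simp [hp, Nat.even_add_one, h]

theorem reachable_inl_inr_of_odd {x : V} (p : G.Walk x x) (hp : Odd p.length) :
    G.bipartiteDoubleCover.Reachable (.inl x) (.inr x) := by
  simpa only [Nat.not_even_iff_odd.2 hp, if_false] using reachable_bipartiteDoubleCover p

variable [G.LocallyFinite]

instance locallyFinite_bipartiteDoubleCover : G.bipartiteDoubleCover.LocallyFinite
  | .inl v => Fintype.ofFinset ((G.neighborFinset v).map .inr) (by rintro (w | w) <;> simp)
  | .inr v => Fintype.ofFinset ((G.neighborFinset v).map .inl) (by rintro (w | w) <;> simp)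

theorem neighborFinset_bipartiteDoubleCover_inl (v : V) :
    G.bipartiteDoubleCover.neighborFinset (.inl v) = (G.neighborFinset v).map .inr := by
  ext (w | w) <;> rw [mem_neighborFinset] <;> simp

theorem neighborFinset_bipartiteDoubleCover_inr (v : V) :
    G.bipartiteDoubleCover.neighborFinset (.inr v) = (G.neighborFinset v).map .inl := by
  ext (w | w) <;> rw [mem_neighborFinset] <;> simp

theorem degree_bipartiteDoubleCover (v : V ⊕ V) :
    G.bipartiteDoubleCover.degree v = G.degree (v.elim id id) := by
  rcases v with v | v
  · rw [← card_neighborFinset_eq_degree, neighborFinset_bipartiteDoubleCover_inl, Finset.card_map]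
    rfl
  · rw [← card_neighborFinset_eq_degree, neighborFinset_bipartiteDoubleCover_inr, Finset.card_map]
    rfl

theorem sum_sum_elim_le {a b c : V → ℝ} (ha : 0 ≤ a) (hb : 0 ≤ b) (hab : ∀ v, a v + b v ≤ c v)
    {m : ℝ} (hm : ∀ s : Finset V, ∑ v ∈ s, c v ≤ m) (s : Finset (V ⊕ V)) :
    ∑ v ∈ s, Sum.elim a b v ≤ m := by
  classical
  have hs : s ⊆ (s.toLeft ∪ s.toRight).disjSum (s.toLeft ∪ s.toRight) := by
    intro v hv
    rcases v with v | v <;> simp [hv]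
  refine le_trans ?_ (hm (s.toLeft ∪ s.toRight))
  calc ∑ v ∈ s, Sum.elim a b v
      ≤ ∑ v ∈ (s.toLeft ∪ s.toRight).disjSum (s.toLeft ∪ s.toRight), Sum.elim a b v :=
        Finset.sum_le_sum_of_subset_of_nonneg hs fun v _ _ => by
          rcases v with v | v
          exacts [ha v, hb v]
    _ = ∑ v ∈ s.toLeft ∪ s.toRight, (a v + b v) := by
        simp only [Finset.sum_disjSum, Sum.elim_inl, Sum.elim_inr, Finset.sum_add_distrib]
    _ ≤ ∑ v ∈ s.toLeft ∪ s.toRight, c v := Finset.sum_le_sum fun v _ => hab v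

theorem sq_posPart_add_sq_negPart (a : ℝ) : a⁺ ^ 2 + a⁻ ^ 2 = a ^ 2 := by
  rcases le_total 0 a with ha | ha <;> simp [ha]

theorem sq_posPart_sub_negPart_add_sq_le (a b : ℝ) :
    (a⁺ - b⁻) ^ 2 + (a⁻ - b⁺) ^ 2 ≤ (a + b) ^ 2 := by
  rcases le_total 0 a with ha | ha <;> rcases le_total 0 b with hb | hb <;>
    simp only [posPart_of_nonneg, negPart_of_nonneg, posPart_of_nonpos, negPart_of_nonpos, ha, hb]
  · nlinarith [mul_nonneg ha hb]
  · exact le_of_eq (by ring)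
  · exact le_of_eq (by ring)
  · nlinarith [mul_nonneg_of_nonpos_of_nonpos ha hb]

theorem mul_pow_four_le_of_odd {d : ℕ} (hd : ∀ v, d ≤ G.degree v) {x : V} (p : G.Walk x x)
    (hp : Odd p.length) {h : V → ℝ} {m E : ℝ} (hm : ∀ s : Finset V, ∑ v ∈ s, h v ^ 2 ≤ m)
    (hE : ∀ s : Finset V, ∑ v ∈ s, ∑ u ∈ G.neighborFinset v, (h v + h u) ^ 2 ≤ E) :
    d * h x ^ 4 ≤ 8 * E * (3 * m + E) := by
  let g : V ⊕ V → ℝ := Sum.elim (fun v => (h v)⁺) (fun v => (h v)⁻)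
  have mass_lift (s : Finset (V ⊕ V)) : ∑ v ∈ s, g v ^ 2 ≤ m := by
    convert sum_sum_elim_le (a := fun v => (h v)⁺ ^ 2) (b := fun v => (h v)⁻ ^ 2)
      (fun _ => sq_nonneg _) (fun _ => sq_nonneg _)
      (fun v => (sq_posPart_add_sq_negPart (h v)).le) hm s using 3 with v
    rcases v with v | v <;> rfl
  have energy_lift (s : Finset (V ⊕ V)) :
      ∑ v ∈ s, ∑ u ∈ G.bipartiteDoubleCover.neighborFinset v, (g v - g u) ^ 2 ≤ E := by
    convert sum_sum_elim_le (a := fun v => ∑ u ∈ G.neighborFinset v, ((h v)⁺ - (h u)⁻) ^ 2)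
      (b := fun v => ∑ u ∈ G.neighborFinset v, ((h v)⁻ - (h u)⁺) ^ 2)
      (fun _ => Finset.sum_nonneg fun _ _ => sq_nonneg _)
      (fun _ => Finset.sum_nonneg fun _ _ => sq_nonneg _)
      (fun v => ?_) hE s using 2 with v
    · rcases v with v | v
      · rw [neighborFinset_bipartiteDoubleCover_inl, Finset.sum_map]; rfl
      · rw [neighborFinset_bipartiteDoubleCover_inr, Finset.sum_map]; rfl
    · rw [← Finset.sum_add_distrib]
      exact Finset.sum_le_sum fun u _ => sq_posPart_sub_negPart_add_sq_le _ _
  have sq_sub_sq_sq : ((h x)⁺ ^ 2 - (h x)⁻ ^ 2) ^ 2 = h x ^ 4 := by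
    rcases le_total 0 (h x) with hx | hx <;> simp [hx] <;> ring
  rw [← sq_sub_sq_sq]
  exact mul_sq_sub_sq_sq_le (fun v => (hd _).trans_eq (degree_bipartiteDoubleCover v).symm)
    (reachable_inl_inr_of_odd p hp) mass_lift energy_lift

end BipartiteDoubleCover

section Delocalization

open SimpleGraph

variable {V : Type*} {G : SimpleGraph V} [G.LocallyFinite] {d : ℕ} {h : V → ℝ} {m : ℝ}

theorem mul_sq_le_two_mul_mass_add_energy (hd : ∀ v, d ≤ G.degree v) (x : V) {E : ℝ}
    (hm : ∀ s : Finset V, ∑ v ∈ s, h v ^ 2 ≤ m)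
    (hE : ∀ s : Finset V, ∑ v ∈ s, ∑ u ∈ G.neighborFinset v, (h v + h u) ^ 2 ≤ E) :
    d * h x ^ 2 ≤ 2 * (m + E) := by
  have mass_neighbors := hm (G.neighborFinset x)
  have energy_at : ∑ u ∈ G.neighborFinset x, (h x + h u) ^ 2 ≤ E := by simpa using hE {x}
  calc d * h x ^ 2 ≤ (G.neighborFinset x).card * h x ^ 2 := by
        rw [card_neighborFinset_eq_degree]
        gcongr
        exact hd x
    _ ≤ 2 * (∑ u ∈ G.neighborFinset x, h u ^ 2 + ∑ u ∈ G.neighborFinset x, (h x + h u) ^ 2) := by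
        simpa only [neg_sq, sub_neg_eq_add] using
          card_mul_sq_le (G.neighborFinset x) (h x) fun u => -h u
    _ ≤ 2 * (m + E) := by gcongr

theorem mul_pow_four_le_hundred_mul (hd : ∀ v, d ≤ G.degree v) {x : V} (p : G.Walk x x)
    (hp : Odd p.length) {δ : ℝ} (hδ : 0 ≤ δ) (hm : ∀ s : Finset V, ∑ v ∈ s, h v ^ 2 ≤ m)
    (hE : ∀ s : Finset V,
      ∑ v ∈ s, ∑ u ∈ G.neighborFinset v, (h v + h u) ^ 2 ≤ 2 * δ * d * m) :
    d * h x ^ 4 ≤ 100 * (d * δ * m ^ 2) := by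
  have hm₀ : 0 ≤ m := by simpa using hm ∅
  have hdδm : 0 ≤ d * δ * m ^ 2 := by positivity
  rcases le_total (δ * d) 1 with hsmall | hlarge
  · calc d * h x ^ 4 ≤ 8 * (2 * δ * d * m) * (3 * m + 2 * δ * d * m) :=
          mul_pow_four_le_of_odd hd p hp hm hE
      _ = 16 * (d * δ * m ^ 2) * (3 + 2 * (δ * d)) := by ring
      _ ≤ 16 * (d * δ * m ^ 2) * (3 + 2 * 1) := by gcongr
      _ ≤ 100 * (d * δ * m ^ 2) := by linarith
  · have hx_mass : h x ^ 2 ≤ m := by simpa using hm {x}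
    calc d * h x ^ 4 = d * h x ^ 2 * h x ^ 2 := by ring
      _ ≤ 2 * (m + 2 * δ * d * m) * m := by
          have := mul_sq_le_two_mul_mass_add_energy hd x hm hE
          gcongr
      _ = (2 * 1 + 4 * (δ * d)) * m ^ 2 := by ring
      _ ≤ (2 * (δ * d) + 4 * (δ * d)) * m ^ 2 := by gcongr
      _ ≤ 100 * (d * δ * m ^ 2) := by linarith

theorem sq_le_ten_mul_sqrt_mul (hd₀ : 0 < d) (hd : ∀ v, d ≤ G.degree v) {x : V}
    (p : G.Walk x x) (hp : Odd p.length) {δ : ℝ} (hm : ∀ s : Finset V, ∑ v ∈ s, h v ^ 2 ≤ m)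
    (hE : ∀ s : Finset V,
      ∑ v ∈ s, ∑ u ∈ G.neighborFinset v, (h v + h u) ^ 2 ≤ 2 * δ * d * m) :
    h x ^ 2 ≤ 10 * √δ * m := by
  have hd_pos : (0 : ℝ) < d := mod_cast hd₀
  have hm₀ : 0 ≤ m := by simpa using hm ∅
  rcases le_or_gt 0 δ with hδ | hδ
  · rw [← sq_le_sq₀ (sq_nonneg _) (by positivity), mul_pow, mul_pow, Real.sq_sqrt hδ]
    refine le_of_mul_le_mul_left ?_ hd_pos
    linarith [mul_pow_four_le_hundred_mul hd p hp hδ hm hE]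
  · have hm_zero : m = 0 := by
      have energy_nonneg : 0 ≤ 2 * δ * d * m := by simpa using hE ∅
      nlinarith [mul_neg_of_neg_of_pos hδ hd_pos]
    simpa [hm_zero] using hm {x}

end Delocalization

section SpectralSubspace

theorem re_inner_apply_le_of_mem_spectralSubspace {H : Type*} [NormedAddCommGroup H]
    [InnerProductSpace ℂ H] [CompleteSpace H] {T : H →L[ℂ] H} (hT : IsSelfAdjoint T) {S : Set ℝ}
    {δ : ℝ} (hS : ∀ s ∈ S, s ≤ δ) {F : H} (hF : F ∈ spectralSubspace T S) :
    RCLike.re (inner ℂ F (T F)) ≤ δ * ‖F‖ ^ 2 := by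
  -- `s ≤ δ + f s` for all `s`, while `f` vanishes on `S` and so `f(T)` kills `F`
  let f : ℝ → ℝ := fun s => max (s - δ) 0
  have hf : Continuous f := by fun_prop
  have cfc_apply_eq_zero : (cfc f T : H →L[ℂ] H) F = 0 :=
    (Submodule.mem_iInf _).1 hF ⟨f, hf, fun s hs => max_eq_right (by linarith [hS s hs])⟩
  have operator_le : T ≤ algebraMap ℝ (H →L[ℂ] H) δ + cfc f T := by
    rw [← cfc_const_add δ f T]
    conv_lhs => rw [← cfc_id' ℝ T]
    exact cfc_mono fun s _ => by linarith [le_max_left (s - δ) 0]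
  have form_nonneg := ((ContinuousLinearMap.le_def _ _).1 operator_le).re_inner_nonneg_right F
  rw [sub_apply, add_apply, cfc_apply_eq_zero, add_zero, inner_sub_right, map_sub, sub_nonneg]
    at form_nonneg
  refine form_nonneg.trans_eq ?_
  rw [Algebra.algebraMap_eq_smul_one, smul_apply, one_apply_eq_self, inner_smul_right_eq_smul,
    RCLike.smul_re, inner_self_eq_norm_sq]

end SpectralSubspace

section SignlessEnergy

open SimpleGraph

variable {V : Type*} {G : SimpleGraph V} [G.LocallyFinite]

theorem sum_norm_add_sq {ι 𝕜 E : Type*} [RCLike 𝕜] [NormedAddCommGroup E] [InnerProductSpace 𝕜 E]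
    (s : Finset ι) (a : E) (f : ι → E) :
    ∑ i ∈ s, ‖a + f i‖ ^ 2 =
      s.card * ‖a‖ ^ 2 + ∑ i ∈ s, ‖f i‖ ^ 2 + 2 * RCLike.re (inner 𝕜 a (∑ i ∈ s, f i)) := by
  simp only [norm_add_sq (𝕜 := 𝕜), Finset.sum_add_distrib, ← Finset.mul_sum, inner_sum, map_sum,
    Finset.sum_const, nsmul_eq_mul]
  ring

theorem hasSum_sum_neighborFinset {a : V → ℝ} (ha : 0 ≤ a) {s : ℝ}
    (hs : HasSum (fun x => G.degree x * a x) s) :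
    HasSum (fun x => ∑ y ∈ G.neighborFinset x, a y) s := by
  have hs_nonneg : 0 ≤ s := hs.nonneg fun x => mul_nonneg (Nat.cast_nonneg _) (ha x)
  have tsum_eq : ∑' x, ENNReal.ofReal (∑ y ∈ G.neighborFinset x, a y) = ENNReal.ofReal s := by
    simp only [ENNReal.ofReal_sum_of_nonneg fun y _ => ha y, G.tsum_degree_mul, ← hs.tsum_eq,
      ENNReal.ofReal_tsum_of_nonneg (fun x => mul_nonneg (Nat.cast_nonneg _) (ha x)) hs.summable,
      ENNReal.ofReal_mul (Nat.cast_nonneg _), ENNReal.ofReal_natCast]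
  have := ENNReal.hasSum_toReal (tsum_eq ▸ ENNReal.ofReal_ne_top)
  rw [← ENNReal.tsum_toReal_eq fun _ => ENNReal.ofReal_ne_top, tsum_eq,
    ENNReal.toReal_ofReal hs_nonneg] at this
  exact this.congr_fun fun x =>
    (ENNReal.toReal_ofReal (Finset.sum_nonneg fun y _ => ha y)).symm

theorem hasSum_sum_norm_add_sq {𝕜 E : Type*} [RCLike 𝕜] [NormedAddCommGroup E]
    [InnerProductSpace 𝕜 E] {f : V → E} {m q : ℝ}
    (hm : HasSum (fun x => G.degree x * ‖f x‖ ^ 2) m)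
    (hq : HasSum (fun x => RCLike.re (inner 𝕜 (f x) (∑ y ∈ G.neighborFinset x, f y))) q) :
    HasSum (fun x => ∑ y ∈ G.neighborFinset x, ‖f x + f y‖ ^ 2) (2 * (m + q)) := by
  have mass_neighbors := hasSum_sum_neighborFinset (fun x => sq_nonneg ‖f x‖) hm
  convert (hm.add mass_neighbors).add (hq.mul_left 2) using 1
  · ext x
    rw [sum_norm_add_sq (𝕜 := 𝕜), card_neighborFinset_eq_degree]
  · ring

end SignlessEnergy

section VertexSpectralMeasure

open SimpleGraph

variable {V : Type*} {G : SimpleGraph V} [G.LocallyFinite]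

theorem hasSum_degree_mul_norm_sq (F : G.WeightedL2) :
    HasSum (fun x => G.degree x * ‖F x‖ ^ 2) (‖F‖ ^ 2) := by
  convert RCLike.hasSum_re ℂ (G.hasSum_inner F F) using 1
  · ext x
    rw [← Complex.ofReal_natCast, RCLike.re_to_complex, Complex.re_ofReal_mul,
      ← RCLike.re_to_complex, inner_self_eq_norm_sq]
  · rw [inner_self_eq_norm_sq]

theorem degree_mul_transitionOp_apply (F : G.WeightedL2) (x : V) :
    G.degree x * G.transitionOp F x = ∑ y ∈ G.neighborFinset x, F y := by
  rcases eq_or_ne (G.degree x) 0 with hx | hx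
  · have : G.neighborFinset x = ∅ := by
      rwa [← Finset.card_eq_zero, card_neighborFinset_eq_degree]
    simp [hx, this]
  · rw [G.transitionOp_apply F hx, G.transitionFun_eq, mul_inv_cancel_left₀ (mod_cast hx)]

theorem hasSum_sum_norm_add_sq_signlessLaplacian (F : G.WeightedL2) :
    HasSum (fun x => ∑ y ∈ G.neighborFinset x, ‖F x + F y‖ ^ 2)
      (2 * RCLike.re (inner ℂ F (G.signlessLaplacian F))) := by
  have quadratic_form : HasSum
      (fun x => RCLike.re (inner ℂ (F x) (∑ y ∈ G.neighborFinset x, F y)))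
      (RCLike.re (inner ℂ F (G.transitionOp F))) := by
    convert RCLike.hasSum_re ℂ (G.hasSum_inner F (G.transitionOp F)) using 2 with x
    rw [← degree_mul_transitionOp_apply, ← smul_eq_mul, inner_smul_right]
  convert hasSum_sum_norm_add_sq (hasSum_degree_mul_norm_sq F) quadratic_form using 2
  rw [signlessLaplacian, add_apply, ContinuousLinearMap.id_apply, inner_add_right, map_add,
    inner_self_eq_norm_sq]

theorem sq_re_le_sq_norm (z : ℂ) : z.re ^ 2 ≤ ‖z‖ ^ 2 :=
  sq_le_sq.2 <| (Complex.abs_re_le_norm z).trans (le_abs_self _)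

theorem sum_degree_mul_sq_re_le (F : G.WeightedL2) (s : Finset V) :
    ∑ v ∈ s, G.degree v * (F v).re ^ 2 ≤ ‖F‖ ^ 2 :=
  (Finset.sum_le_sum fun v _ =>
    mul_le_mul_of_nonneg_left (sq_re_le_sq_norm (F v)) (Nat.cast_nonneg _)).trans
    (sum_le_hasSum s (fun _ _ => by positivity) (hasSum_degree_mul_norm_sq F))

theorem sum_sum_re_add_re_sq_le (F : G.WeightedL2) (s : Finset V) :
    ∑ v ∈ s, ∑ u ∈ G.neighborFinset v, ((F v).re + (F u).re) ^ 2 ≤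
      2 * RCLike.re (inner ℂ F (G.signlessLaplacian F)) :=
  (Finset.sum_le_sum fun v _ => Finset.sum_le_sum fun u _ => sq_re_le_sq_norm (F v + F u)).trans
    (sum_le_hasSum s (fun _ _ => Finset.sum_nonneg fun _ _ => sq_nonneg _)
      (hasSum_sum_norm_add_sq_signlessLaplacian F))

theorem inner_vertexVector (F : G.WeightedL2) (x : V) :
    inner ℂ F (G.vertexVector x) = √(G.degree x : ℝ) * starRingEnd ℂ (F x) := by
  have vertexVector_apply : ∀ y, G.degree y ≠ 0 → G.vertexVector x y =
      Set.indicator {x} (fun _ => (((√(G.degree x : ℝ))⁻¹ : ℝ) : ℂ)) y :=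
    (G.ae_vertexMeasure_iff _).1 indicatorConstLp_coeFn
  have support (y : V) (hy : y ≠ x) :
      (G.degree y : ℂ) * inner ℂ (F y) (G.vertexVector x y) = 0 := by
    rcases eq_or_ne (G.degree y) 0 with h | h
    · simp [h]
    · simp [vertexVector_apply y h, hy]
  rw [(G.hasSum_inner F _).unique (hasSum_single x support)]
  rcases eq_or_ne (G.degree x) 0 with h | h
  · simp [h]
  · have degree_div_sqrt : (G.degree x : ℂ) * ((√(G.degree x : ℝ))⁻¹ : ℝ) = √(G.degree x : ℝ) := by
      rw [← Complex.ofReal_natCast, ← Complex.ofReal_mul, ← div_eq_mul_inv, Real.div_sqrt]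
    rw [vertexVector_apply x h, Set.indicator_of_mem (Set.mem_singleton x), RCLike.inner_apply,
      ← mul_assoc, degree_div_sqrt]

theorem vertexSpectralMeasure_eq_norm_sq (x : V) (δ : ℝ) :
    G.vertexSpectralMeasure x δ =
      ‖spectralProjection G.signlessLaplacian (Set.Icc 0 δ) (G.vertexVector x)‖ ^ 2 :=
  Submodule.re_inner_starProjection_eq_normSq _ _

theorem vertexSpectralMeasure_eq_sqrt_degree_mul (x : V) (δ : ℝ) :
    G.vertexSpectralMeasure x δ = √(G.degree x : ℝ) *
      (spectralProjection G.signlessLaplacian (Set.Icc 0 δ) (G.vertexVector x) x).re := by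
  rw [vertexSpectralMeasure, inner_vertexVector, RCLike.re_to_complex, Complex.re_ofReal_mul,
    Complex.conj_re]

theorem le_of_sq_le_mul {a c : ℝ} (hc : 0 ≤ c) (h : a ^ 2 ≤ c * a) : a ≤ c := by
  rcases le_or_gt a 0 with ha | ha
  · exact ha.trans hc
  · exact le_of_mul_le_mul_right (by rwa [← sq]) ha

theorem mul_vertexSpectralMeasure_le {d : ℕ} (hd₀ : 0 < d) (hd : ∀ v, d ≤ G.degree v) {x : V}
    (p : G.Walk x x) (hp : Odd p.length) (δ : ℝ) :
    d * G.vertexSpectralMeasure x δ ≤ G.degree x * (10 * √δ) := by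
  set F := spectralProjection G.signlessLaplacian (Set.Icc 0 δ) (G.vertexVector x)
  set μ := G.vertexSpectralMeasure x δ with hμ
  have hμ_norm : μ = ‖F‖ ^ 2 := vertexSpectralMeasure_eq_norm_sq x δ
  have hμ_sq : μ ^ 2 = G.degree x * (F x).re ^ 2 := by
    rw [hμ, vertexSpectralMeasure_eq_sqrt_degree_mul, mul_pow, Real.sq_sqrt (Nat.cast_nonneg _)]
  have hd_pos : (0 : ℝ) < d := mod_cast hd₀
  have mass_le (s : Finset V) : ∑ v ∈ s, (F v).re ^ 2 ≤ μ / d := by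
    rw [le_div_iff₀' hd_pos, Finset.mul_sum, hμ_norm]
    refine (Finset.sum_le_sum fun v _ => ?_).trans (sum_degree_mul_sq_re_le F s)
    exact mul_le_mul_of_nonneg_right (mod_cast hd v) (sq_nonneg _)
  have energy_le (s : Finset V) :
      ∑ v ∈ s, ∑ u ∈ G.neighborFinset v, ((F v).re + (F u).re) ^ 2 ≤ 2 * δ * d * (μ / d) := by
    have form_le : RCLike.re (inner ℂ F (G.signlessLaplacian F)) ≤ δ * ‖F‖ ^ 2 :=
      re_inner_apply_le_of_mem_spectralSubspace G.isSelfAdjoint_signlessLaplacian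
        (fun _ hs => hs.2) (Submodule.starProjection_apply_mem _ _)
    calc ∑ v ∈ s, ∑ u ∈ G.neighborFinset v, ((F v).re + (F u).re) ^ 2
        ≤ 2 * RCLike.re (inner ℂ F (G.signlessLaplacian F)) := sum_sum_re_add_re_sq_le F s
      _ ≤ 2 * (δ * μ) := by rw [hμ_norm]; gcongr
      _ = 2 * δ * d * (μ / d) := by field_simp
  have sq_re_le := sq_le_ten_mul_sqrt_mul hd₀ hd p hp mass_le energy_le
  rw [← le_div_iff₀' hd_pos]
  refine le_of_sq_le_mul (by positivity) ?_
  calc μ ^ 2 = G.degree x * (F x).re ^ 2 := hμ_sq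
    _ ≤ G.degree x * (10 * √δ * (μ / d)) := by gcongr
    _ = G.degree x * (10 * √δ) / d * μ := by ring

end VertexSpectralMeasure

section LowEigenprojection

open scoped ComplexOrder MatrixOrder

variable {n 𝕜 : Type*} [RCLike 𝕜] [Fintype n] [DecidableEq n] {M : Matrix n n 𝕜}

/-- The spectral projection `1_{(-∞, t]}(M)` of a Hermitian matrix `M`, that is, the orthogonal
projection onto the sum of the eigenspaces of `M` for the eigenvalues at most `t`. The spectrum is
finite, so the continuous functional calculus applies to the indicator of `(-∞, t]`. -/
noncomputable def lowEigenprojection (M : Matrix n n 𝕜) (t : ℝ) : Matrix n n 𝕜 :=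
  cfc ((Set.Iic t).indicator 1 : ℝ → ℝ) M

theorem continuousOn_spectrum_matrix (M : Matrix n n 𝕜) (f : ℝ → ℝ) :
    ContinuousOn f (spectrum ℝ M) :=
  M.finite_real_spectrum.continuousOn f

theorem isHermitian_lowEigenprojection (M : Matrix n n 𝕜) (t : ℝ) :
    (lowEigenprojection M t).IsHermitian :=
  cfc_predicate _ M

theorem lowEigenprojection_mul_self (M : Matrix n n 𝕜) (t : ℝ) :
    lowEigenprojection M t * lowEigenprojection M t = lowEigenprojection M t := by
  rw [lowEigenprojection, ← cfc_mul _ _ M (continuousOn_spectrum_matrix M _)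
    (continuousOn_spectrum_matrix M _)]
  congr! 2 with s
  by_cases hs : s ≤ t <;> simp [hs]

theorem trace_cfc (hM : M.IsHermitian) (f : ℝ → ℝ) :
    (cfc f M).trace = ∑ j, (f (hM.eigenvalues j) : 𝕜) := by
  rw [hM.cfc_eq, Matrix.IsHermitian.cfc, Unitary.conjStarAlgAut_apply, Matrix.trace_mul_cycle,
    Unitary.coe_star_mul_self, one_mul, Matrix.trace_diagonal]
  rfl

theorem trace_lowEigenprojection (hM : M.IsHermitian) (t : ℝ) :
    (lowEigenprojection M t).trace = Fintype.card {j // hM.eigenvalues j ≤ t} := by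
  simp [lowEigenprojection, trace_cfc hM, Set.indicator_apply, Fintype.card_subtype, apply_ite]

theorem lowEigenprojection_mul_mul_self_le (hM : M.IsHermitian) (t : ℝ) :
    lowEigenprojection M t * M * lowEigenprojection M t ≤ t • lowEigenprojection M t := by
  let χ : ℝ → ℝ := (Set.Iic t).indicator 1
  have hcont (f : ℝ → ℝ) := continuousOn_spectrum_matrix M f
  calc lowEigenprojection M t * M * lowEigenprojection M t
      = cfc (fun s => χ s * s * χ s) M := by
        rw [cfc_mul _ _ M (hcont _) (hcont _), cfc_mul _ _ M (hcont _) (hcont _),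
          cfc_id' ℝ M hM.isSelfAdjoint]
        rfl
    _ ≤ cfc (fun s => t • χ s) M := by
        refine cfc_mono (fun s _ => ?_) (hcont _) (hcont _)
        by_cases hs : s ≤ t <;> simp [χ, hs]
    _ = t • lowEigenprojection M t := cfc_smul t χ M (hcont χ)

end LowEigenprojection

section OrderedSpectrum

variable {V : Type*} [Fintype V] [DecidableEq V] {M : Matrix V V ℝ}

theorem exists_isOrderedSpectrum (hM : M.IsHermitian) :
    ∃ lam : Fin (Fintype.card V) → ℝ, IsOrderedSpectrum M lam := by
  refine ⟨fun k => hM.eigenvalues₀ k.rev,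
    fun i j hij => hM.eigenvalues₀_antitone (Fin.rev_le_rev.2 hij), ?_⟩
  rw [hM.roots_charpoly_eq_eigenvalues₀]
  conv_lhs => rw [← Multiset.map_univ_val_equiv Fin.revPerm, Multiset.map_map]
  rfl

namespace IsOrderedSpectrum

variable {n : ℕ} {lam : Fin n → ℝ}

theorem succ_le_card_eigenvalues_le (hlam : IsOrderedSpectrum M lam) (hM : M.IsHermitian)
    (k : Fin n) : (k : ℕ) + 1 ≤ Fintype.card {j // hM.eigenvalues j ≤ lam k} := by
  have roots_eq : Finset.univ.val.map hM.eigenvalues = Finset.univ.val.map lam :=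
    hM.roots_charpoly_eq_eigenvalues.symm.trans hlam.2
  have card_eq := congrArg (Multiset.countP (· ≤ lam k)) roots_eq
  rw [Multiset.countP_map, Multiset.countP_map] at card_eq
  calc (k : ℕ) + 1 = (Finset.Iic k).card := (Fin.card_Iic k).symm
    _ ≤ (Finset.univ.filter fun i => lam i ≤ lam k).card :=
        Finset.card_le_card fun i hi => by simpa using hlam.1 (Finset.mem_Iic.1 hi)
    _ = Fintype.card {j // hM.eigenvalues j ≤ lam k} := by
        rw [Fintype.card_subtype]
        exact card_eq.symm

theorem sub_scalar (hlam : IsOrderedSpectrum M lam) (μ : ℝ) :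
    IsOrderedSpectrum (M - Matrix.scalar V μ) fun k => lam k - μ := by
  refine ⟨fun i j hij => sub_le_sub_right (hlam.1 hij) μ, ?_⟩
  have shift : (Polynomial.X + Polynomial.C μ : Polynomial ℝ) =
      Polynomial.C 1 * Polynomial.X + Polynomial.C μ := by simp
  rw [Matrix.charpoly_sub_scalar, shift, Polynomial.roots_comp_C_mul_X_add_C _ _ _ isUnit_one,
    hlam.2, Multiset.map_map]
  simp

end IsOrderedSpectrum

end OrderedSpectrum

section OddClosedWalk

open SimpleGraph

variable {V : Type*} {G : SimpleGraph V}

theorem exists_odd_closed_walk (hconn : G.Connected) (hnb : ¬ G.IsBipartite) (x : V) :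
    ∃ p : G.Walk x x, Odd p.length := by
  rw [IsBipartite, two_colorable_iff_forall_loop_even] at hnb
  push Not at hnb
  obtain ⟨u, c, hc⟩ := hnb
  obtain ⟨q⟩ := hconn.preconnected x u
  refine ⟨(q.append c).append q.reverse, ?_⟩
  rw [Nat.not_even_iff_odd] at hc
  simp only [Walk.length_append, Walk.length_reverse]
  grind

theorem degree_pos_of_odd_closed_walk [G.LocallyFinite] {x : V} (p : G.Walk x x)
    (hp : Odd p.length) : 0 < G.degree x :=
  (G.degree_pos_iff_exists_adj x).2 ⟨p.getVert 1, by simpa using p.adj_getVert_succ hp.pos⟩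

end OddClosedWalk

section RegularGraph

open SimpleGraph Matrix
open scoped MatrixOrder

variable {V : Type*} {G : SimpleGraph V} [G.LocallyFinite] {d : ℕ}

theorem isHermitian_transitionMatrix (hreg : G.IsRegularOfDegree d) :
    G.transitionMatrix.IsHermitian := by
  ext x y
  simp only [transitionMatrix, conjTranspose_apply, of_apply, hreg.degree_eq, star_trivial]
  congr! 1
  exact G.adj_comm y x

theorem degree_mul_transitionMatrix_mulVec [Fintype V] (h : V → ℝ) (x : V) :
    G.degree x * (G.transitionMatrix *ᵥ h) x = ∑ y ∈ G.neighborFinset x, h y := by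
  classical
  have entry (y : V) :
      G.degree x * (G.transitionMatrix x y * h y) = if G.Adj x y then h y else 0 := by
    by_cases hxy : G.Adj x y
    · have : (G.degree x : ℝ) ≠ 0 := mod_cast hxy.degree_pos_left.ne'
      simp [transitionMatrix, hxy, this]
    · simp [transitionMatrix, hxy]
  rw [mulVec, dotProduct, Finset.mul_sum, Finset.sum_congr rfl fun y _ => entry y,
    ← Finset.sum_filter]
  exact Finset.sum_congr (by ext; simp) fun _ _ => rfl

theorem sum_sum_add_sq_eq_dotProduct [Fintype V] [DecidableEq V] (hreg : G.IsRegularOfDegree d)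
    (h : V → ℝ) :
    ∑ x, ∑ y ∈ G.neighborFinset x, (h x + h y) ^ 2 =
      2 * d * (h ⬝ᵥ (1 + G.transitionMatrix) *ᵥ h) := by
  have energy := hasSum_sum_norm_add_sq (G := G) (𝕜 := ℝ) (f := h) (hasSum_fintype _)
    (hasSum_fintype _)
  simp only [Real.norm_eq_abs, sq_abs] at energy
  rw [(hasSum_fintype _).unique energy, add_mulVec, one_mulVec, dotProduct_add, dotProduct,
    dotProduct, ← Finset.sum_add_distrib, ← Finset.sum_add_distrib, mul_assoc,
    Finset.mul_sum _ _ (d : ℝ)]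
  congr 1
  refine Finset.sum_congr rfl fun x _ => ?_
  rw [← degree_mul_transitionMatrix_mulVec, hreg.degree_eq]
  simp
  ring

theorem mul_mul_self_apply_self {n R : Type*} [Fintype n] [CommSemiring R] {A : Matrix n n R}
    (hA : A.IsSymm) (M : Matrix n n R) (i : n) :
    (A * M * A) i i = A i ⬝ᵥ M *ᵥ A i := by
  rw [Matrix.mul_assoc, mul_apply_eq_vecMul, ← vecMul_vecMul, dotProduct_mulVec]
  exact congrArg (A i ᵥ* M ⬝ᵥ ·) (funext fun j => hA.apply i j)

theorem lowEigenprojection_apply_self_le [Fintype V] [DecidableEq V]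
    (hreg : G.IsRegularOfDegree d) {x : V} (p : G.Walk x x) (hp : Odd p.length) (t : ℝ) :
    lowEigenprojection (1 + G.transitionMatrix) t x x ≤ 10 * √t := by
  have hd : 0 < d := hreg.degree_eq x ▸ degree_pos_of_odd_closed_walk p hp
  let M : Matrix V V ℝ := 1 + G.transitionMatrix
  have hM : M.IsHermitian := isHermitian_one.add (isHermitian_transitionMatrix hreg)
  let E : Matrix V V ℝ := lowEigenprojection M t
  have hE_symm : E.IsSymm := isHermitian_lowEigenprojection M t
  have mass_eq : ∑ v, E x v ^ 2 = E x x := by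
    have idem : E * 1 * E = E := by rw [mul_one]; exact lowEigenprojection_mul_self M t
    calc ∑ v, E x v ^ 2 = E x ⬝ᵥ 1 *ᵥ E x := by simp [dotProduct, sq]
      _ = E x x := by rw [← mul_mul_self_apply_self hE_symm, idem]
  have energy_le :
      ∑ v, ∑ u ∈ G.neighborFinset v, (E x v + E x u) ^ 2 ≤ 2 * t * d * E x x := by
    have form_le : E x ⬝ᵥ M *ᵥ E x ≤ t * E x x := by
      have := (le_iff.1 (lowEigenprojection_mul_mul_self_le hM t)).diag_nonneg (i := x)
      rw [← mul_mul_self_apply_self hE_symm]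
      simpa using this
    rw [sum_sum_add_sq_eq_dotProduct hreg]
    calc 2 * d * (E x ⬝ᵥ M *ᵥ E x) ≤ 2 * d * (t * E x x) := by gcongr
      _ = 2 * t * d * E x x := by ring
  have sq_le := sq_le_ten_mul_sqrt_mul hd (fun v => (hreg.degree_eq v).ge) p hp
    (fun s => (Finset.sum_le_univ_sum_of_nonneg fun _ => sq_nonneg _).trans_eq mass_eq)
    (fun s => (Finset.sum_le_univ_sum_of_nonneg fun _ => Finset.sum_nonneg fun _ _ =>
      sq_nonneg _).trans energy_le)
  exact le_of_sq_le_mul (by positivity) sq_le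

theorem card_eigenvalues_le_le_mul_sqrt [Fintype V] [DecidableEq V]
    (hreg : G.IsRegularOfDegree d) (hodd : ∀ x, ∃ p : G.Walk x x, Odd p.length)
    (hM : (1 + G.transitionMatrix).IsHermitian) (t : ℝ) :
    Fintype.card {j // hM.eigenvalues j ≤ t} ≤ Fintype.card V * (10 * √t) := by
  rw [← trace_lowEigenprojection (𝕜 := ℝ), trace, ← nsmul_eq_mul]
  refine Finset.sum_le_card_nsmul _ _ _ fun x _ => ?_
  obtain ⟨p, hp⟩ := hodd x
  exact lowEigenprojection_apply_self_le hreg p hp t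

theorem sq_div_le_of_isOrderedSpectrum [Fintype V] [DecidableEq V]
    (hreg : G.IsRegularOfDegree d) (hodd : ∀ x, ∃ p : G.Walk x x, Odd p.length)
    {n : ℕ} {lam : Fin n → ℝ} (hlam : IsOrderedSpectrum (1 + G.transitionMatrix) lam)
    (k : Fin n) : ((k : ℝ) + 1) ^ 2 / (100 * (Fintype.card V : ℝ) ^ 2) ≤ lam k := by
  have hM := isHermitian_one.add (isHermitian_transitionMatrix hreg)
  have count : (k : ℝ) + 1 ≤ Fintype.card V * (10 * √(lam k)) :=
    le_trans (mod_cast hlam.succ_le_card_eigenvalues_le hM k)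
      (card_eigenvalues_le_le_mul_sqrt hreg hodd hM (lam k))
  have hlam_nonneg : 0 ≤ lam k := by
    by_contra! hneg
    rw [Real.sqrt_eq_zero_of_nonpos hneg.le] at count
    linarith [(k : ℕ).cast_nonneg (α := ℝ)]
  refine div_le_of_le_mul₀ (by positivity) hlam_nonneg ?_
  calc ((k : ℝ) + 1) ^ 2 ≤ (Fintype.card V * (10 * √(lam k))) ^ 2 := by gcongr
    _ = lam k * (100 * (Fintype.card V : ℝ) ^ 2) := by
        rw [mul_pow, mul_pow, Real.sq_sqrt hlam_nonneg]; ring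

end RegularGraph

theorem mainTheorem1_general {V : Type*} (G : SimpleGraph V) [G.LocallyFinite] {d : ℕ}
    (hreg : G.IsRegularOfDegree d) (hodd : ∀ x, ∃ p : G.Walk x x, Odd p.length) :
    (∀ (x : V) (δ : ℝ), 0 ≤ δ → G.vertexSpectralMeasure x δ ≤ 10 * √δ) ∧
    (∀ [Fintype V] [DecidableEq V],
      (∃ lamQ : Fin (Fintype.card V) → ℝ,
        IsOrderedSpectrum (1 + G.transitionMatrix) lamQ ∧
        ∀ k : Fin (Fintype.card V),
          ((k : ℝ) + 1) ^ 2 / (100 * (Fintype.card V : ℝ) ^ 2) ≤ lamQ k) ∧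
      (∃ lamP : Fin (Fintype.card V) → ℝ,
        IsOrderedSpectrum G.transitionMatrix lamP ∧
        ∀ k : Fin (Fintype.card V),
          -1 + ((k : ℝ) + 1) ^ 2 / (100 * (Fintype.card V : ℝ) ^ 2) ≤ lamP k)) := by
  refine ⟨fun x δ _ => ?_, ?_⟩
  · obtain ⟨p, hp⟩ := hodd x
    have hd : 0 < d := hreg.degree_eq x ▸ degree_pos_of_odd_closed_walk p hp
    have bound := mul_vertexSpectralMeasure_le hd (fun v => (hreg.degree_eq v).ge) p hp δ
    rw [hreg.degree_eq] at bound
    exact le_of_mul_le_mul_left bound (mod_cast hd)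
  · intro _ _
    obtain ⟨lamQ, hlamQ⟩ := exists_isOrderedSpectrum
      (Matrix.isHermitian_one.add (isHermitian_transitionMatrix hreg))
    have bound := sq_div_le_of_isOrderedSpectrum hreg hodd hlamQ
    refine ⟨⟨lamQ, hlamQ, bound⟩, fun k => lamQ k - 1, ?_, fun k => by linarith [bound k]⟩
    simpa using hlamQ.sub_scalar 1

theorem mainTheorem1 {V : Type*} (G : SimpleGraph V) [G.LocallyFinite] {d : ℕ}
    (hreg : G.IsRegularOfDegree d) (hconn : G.Connected) (hnb : ¬ G.IsBipartite) :
    (∀ (x : V) (δ : ℝ), 0 ≤ δ → δ ≤ 2 → G.vertexSpectralMeasure x δ ≤ 10 * √δ) ∧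
    (∀ [Fintype V] [DecidableEq V],
      (∃ lamQ : Fin (Fintype.card V) → ℝ,
        IsOrderedSpectrum (1 + G.transitionMatrix) lamQ ∧
        ∀ k : Fin (Fintype.card V),
          ((k : ℝ) + 1) ^ 2 / (100 * (Fintype.card V : ℝ) ^ 2) ≤ lamQ k) ∧
      (∃ lamP : Fin (Fintype.card V) → ℝ,
        IsOrderedSpectrum G.transitionMatrix lamP ∧
        ∀ k : Fin (Fintype.card V),
          -1 + ((k : ℝ) + 1) ^ 2 / (100 * (Fintype.card V : ℝ) ^ 2) ≤ lamP k)) :=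
  have ⟨spectralMeasure_le, eigenvalues_ge⟩ :=
    mainTheorem1_general G hreg (exists_odd_closed_walk hconn hnb)
  ⟨fun x δ hδ _ => spectralMeasure_le x δ hδ, eigenvalues_ge⟩
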